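/- Let $A$ be an alphabet, $2=\{0,1\}=\mathbb{Z}_2$, $FX=2\times X^A$, and let $\Omega=2^{A^*}$ be the set of languages over $A$. For an $F$-coalgebra (unpointed deterministic automaton) $k\colon X\to FX$ let $\mathsf{obs}_k\colon X\to\Omega$ assign to each state the language it accepts. Let $\mathcal{H}$ be the neighbourhood monad, $\mathcal{H}X=2^{2^X}$, whose algebras are the complete atomic Boolean algebras (CABAs), and let $\mathcal{R}$ be the free $\mathbb{Z}_2$-vector space monad, $\mathcal{R}X=\{\varphi\colon X\to\mathbb{Z}_2\mid \varphi\text{ has finite support}\}$. For $T\in\{\mathcal{H},\mathcal{R}\}$ let $\lambda^{T}\colon TF\Rightarrow FT$ be the distributive law induced by the output algebra $h^{T}\colon T2\to 2$, where $h^{\mathcal H}(\Phi)=\Phi(\mathrm{id}_2)$ and $h^{\mathcal R}(\varphi)=\varphi(1)$. A $\lambda^{T}$-bialgebra $(X,h,k)$ is a $T$-algebra $(X,h)$ with an $F$-coalgebra $k$ on $X$ such that $k\circ h=Fh\circ\lambda^T_X\circ Tk$. A $\lambda^{\mathcal H}$-bialgebra with a distinguished state $x$ (a CABA-structured deterministic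 automaton) is *minimal accepting $L$* if $\mathsf{obs}_k(x)=L$, the map $\mathsf{obs}_k$ is injective, and every state is reachable by an element of $\mathcal{H}(A^*)$, i.e. the $\mathcal{H}$-algebra homomorphism $\mathcal{H}(A^*)\to X$ extending $w\mapsto(\text{the state reached from }x\text{ by reading }w)$ is surjective. Let $\alpha_X\colon\mathcal{R}X\to\mathcal{H}X$, $\alpha_X(\varphi)(\psi)=\bigoplus_{z\in X}\varphi(z)\cdot\psi(z)$; for an $\mathcal{H}$-algebra $(X,h)$, the $\mathcal{R}$-algebra $(X,h\circ\alpha_X)$ is the CABA viewed as a $\mathbb{Z}_2$-vector space. A basis of an $\mathcal{R}$-algebra $(X,g)$ is a triple $(Y,i\colon Y\to X,d\colon X\to\mathcal{R}Y)$ such that $d$ is a two-sided inverse of $g\circ\mathcal{R}i$. A ($\mathbb{Z}_2$-)weighted automaton $\mathcal{Y}$ with state set $Y$ is a map $k\colon Y\to F\mathcal{R}Y$ together with an initial element $y_0\in\mathcal{R}Y$. With its determinisation $k^\sharp=F\mu_Y\circ\lambda^{\mathcal R}_{\mathcal{R}Y}\circ\mathcal{R}k\colon\mathcal{R}Y\to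 F\mathcal{R}Y$, it accepts the language $\mathsf{obs}_{k^\sharp}(y_0)$, and $\mathsf{obs}^\dagger_{\mathcal Y}:=\mathsf{obs}_{k^\sharp}\circ\eta^{\mathcal R}_Y\colon Y\to\Omega$ gives the languages accepted by its states. For $S\subseteq\Omega$ let $\overline{S}^{\mathbb{Z}_2\text{-}\mathsf{Vect}}$ and $\overline{S}^{\mathsf{CABA}}$ denote the closure of $S$ in $\Omega$ with respect to the pointwise $\mathcal{R}$-algebra (i.e. $\mathbb{Z}_2$-vector space) and the pointwise $\mathcal{H}$-algebra (i.e. CABA) structure, respectively. Call $\mathcal{Y}$ *closed* if $$\overline{\mathrm{im}(\mathsf{obs}^\dagger_{\mathcal Y})}^{\mathbb{Z}_2\text{-}\mathsf{Vect}}=\overline{\mathrm{im}(\mathsf{obs}^\dagger_{\mathcal Y})}^{\mathsf{CABA}}.$$ **Statement.** Let $L\subseteq A^*$ be a regular language. There exists a minimal pointed $\lambda^{\mathcal H}$-bialgebra accepting $L$. Let $(X,h,k)$, with distinguished state $x$, be any such bialgebra. The $\mathcal{R}$-algebra $(X,h\circ\alpha_X)$ has a basis. For any basis $(Y,i,d)$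 of it, let $\mathcal{X}$ be the minimal xor-CABA automaton for $L$ with respect to this basis, that is, the weighted automaton $Fd\circ k\circ i\colon Y\to F\mathcal{R}Y$ with initial element $d(x)$. Then $\mathcal{X}$ has finitely many states, accepts $L$ and is closed, and it is size-minimal among closed weighted automata accepting $L$: every closed weighted automaton accepting $L$, with state set $Z$, satisfies $|Y|\le|Z|$. -/

import Mathlib

universe uA uX uY uZ

namespace XorCABA

/-- The two-element set `2 = {0, 1}`, identified with the field with two elements. -/
abbrev Two : Type := ZMod 2

/-! ### Deterministic automata as coalgebras -/

/-- The functor `F X = 2 × X ^ A`. -/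
abbrev F (A : Type uA) (X : Type uX) : Type (max uA uX) := Two × (A → X)

/-- The action of `F` on functions. -/
def F.map {A : Type uA} {X : Type uX} {Y : Type uY} (f : X → Y) (p : F A X) : F A Y :=
  (p.1, fun a => f (p.2 a))

/-- The set of languages `2 ^ (A*)`, which carries the final `F`-coalgebra. -/
abbrev Lang (A : Type uA) : Type uA := List A → Two

/-- The final coalgebra homomorphism of an `F`-coalgebra: it assigns to a state
the language it accepts. -/
def obs {A : Type uA} {X : Type uX} (k : X → F A X) : X → Lang A
  | x, [] => (k x).1
  | x, a :: v => obs k ((k x).2 a) v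

/-- The state reached from a given state by reading a word. -/
def run {A : Type uA} {X : Type uX} (k : X → F A X) : X → List A → X
  | x, [] => x
  | x, a :: v => run k ((k x).2 a) v

/-- `IsCharFun ξ L`: the function `ξ` is the characteristic function of `L`. -/
def IsCharFun {A : Type uA} (ξ : Lang A) (L : Language A) : Prop :=
  ∀ w : List A, ξ w = 1 ↔ w ∈ L

/-! ### The neighbourhood monad, whose algebras are the CABAs -/

/-- The neighbourhood monad on objects. -/
abbrev Nbhd (X : Type uX) : Type uX := (X → Two) → Two

namespace Nbhd

/-- The action of the neighbourhood monad on functions. -/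
def map {X : Type uX} {Y : Type uY} (f : X → Y) (Φ : Nbhd X) : Nbhd Y :=
  fun φ => Φ (φ ∘ f)

/-- The unit of the neighbourhood monad. -/
def unit {X : Type uX} (x : X) : Nbhd X := fun φ => φ x

/-- The multiplication of the neighbourhood monad. -/
def mult {X : Type uX} (Ψ : Nbhd (Nbhd X)) : Nbhd X :=
  fun φ => Ψ (unit φ)

/-- Eilenberg-Moore algebras over the neighbourhood monad. -/
structure Algebra (X : Type uX) where
  str : Nbhd X → X
  str_unit : ∀ x : X, str (unit x) = x
  str_mult : ∀ Ψ : Nbhd (Nbhd X), str (mult Ψ) = str (map str Ψ)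

/-- The algebra structure `Φ ↦ Φ(id)` on the output set `2`. -/
def out (Φ : Nbhd Two) : Two := Φ id

/-- The distributive law between the neighbourhood monad and `F` that is induced by `out`
(and the canonical strength). -/
def law {A : Type uA} {X : Type uX} (U : Nbhd (F A X)) : F A (Nbhd X) :=
  (out (map Prod.fst U), fun a => map (fun g : A → X => g a) (map Prod.snd U))

/-- The pointwise algebra structure on the set of languages. -/
def langStr {A : Type uA} (U : Nbhd (Lang A)) : Lang A :=
  fun w => out (map (fun ξ : Lang A => ξ w) U)

end Nbhd

/-- The closure of a set `S` of languages in the CABA of all languages,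
that is, the image of `T S → T (2 ^ (A*)) → 2 ^ (A*)` for the neighbourhood monad `T`. -/
def cabaClosure {A : Type uA} (S : Set (Lang A)) : Set (Lang A) :=
  Set.range fun U : Nbhd S => Nbhd.langStr (Nbhd.map Subtype.val U)

/-! ### The free vector space monad over the two-element field -/

/-- The free `ℤ₂`-vector space monad on objects. -/
abbrev Vec (X : Type uX) : Type uX := X →₀ Two

namespace Vec

/-- The action of the free vector space monad on functions. -/
noncomputable def map {X : Type uX} {Y : Type uY} (f : X → Y) (φ : Vec X) : Vec Y :=
  Finsupp.mapDomain f φ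

/-- The unit of the free vector space monad. -/
noncomputable def unit {X : Type uX} (x : X) : Vec X := Finsupp.single x 1

/-- The multiplication of the free vector space monad. -/
noncomputable def mult {X : Type uX} (Φ : Vec (Vec X)) : Vec X :=
  Φ.sum fun φ c => c • φ

/-- Eilenberg-Moore algebras over the free vector space monad. -/
structure Algebra (X : Type uX) where
  str : Vec X → X
  str_unit : ∀ x : X, str (unit x) = x
  str_mult : ∀ Φ : Vec (Vec X), str (mult Φ) = str (map str Φ)

/-- The algebra structure `φ ↦ φ(1)` on the output set `2`. -/
def out (φ : Vec Two) : Two := φ 1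

/-- The distributive law between the free vector space monad and `F` that is induced by `out`
(and the canonical strength). -/
noncomputable def law {A : Type uA} {X : Type uX} (U : Vec (F A X)) : F A (Vec X) :=
  (out (map Prod.fst U), fun a => map (fun g : A → X => g a) (map Prod.snd U))

/-- The pointwise algebra structure on the set of languages. -/
noncomputable def langStr {A : Type uA} (U : Vec (Lang A)) : Lang A :=
  fun w => out (map (fun ξ : Lang A => ξ w) U)

/-- A basis `(Y, i, d)` with carrier `Y` of an algebra over the free vector space monad. -/
structure Basis {X : Type uX} (𝔸 : Algebra X) (Y : Type uY) where
  i : Y → X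
  d : X → Vec Y
  str_map_d : ∀ x : X, 𝔸.str (map i (d x)) = x
  d_str_map : ∀ φ : Vec Y, d (𝔸.str (map i φ)) = φ

end Vec

/-- The closure of a set `S` of languages in the `ℤ₂`-vector space of all languages,
that is, the image of `T S → T (2 ^ (A*)) → 2 ^ (A*)` for the free vector space monad `T`. -/
def vecClosure {A : Type uA} (S : Set (Lang A)) : Set (Lang A) :=
  Set.range fun U : Vec S => Vec.langStr (Vec.map Subtype.val U)

/-! ### From CABAs to vector spaces -/

/-- The natural transformation from the free vector space monad to the neighbourhood monad. -/
noncomputable def alpha {X : Type uX} (φ : Vec X) : Nbhd X :=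
  fun ψ => φ.sum fun x c => c * ψ x

theorem alpha_unit {X : Type uX} (x : X) : alpha (Vec.unit x) = Nbhd.unit x := by
  funext ψ
  simp [alpha, Vec.unit, Nbhd.unit]

theorem alpha_map {X : Type uX} {Y : Type uY} (f : X → Y) (φ : Vec X) :
    alpha (Vec.map f φ) = Nbhd.map f (alpha φ) := by
  funext ψ
  simp only [alpha, Vec.map, Nbhd.map, Function.comp]
  exact Finsupp.sum_mapDomain_index (fun _ => zero_mul _) (fun _ _ _ => add_mul _ _ _)

theorem alpha_mult {X : Type uX} (Φ : Vec (Vec X)) :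
    alpha (Vec.mult Φ) = Nbhd.mult (alpha (Vec.map alpha Φ)) := by
  funext ψ
  rw [alpha_map]
  simp only [alpha, Vec.mult, Nbhd.mult, Nbhd.map, Nbhd.unit, Function.comp]
  rw [Finsupp.sum_sum_index (fun _ => zero_mul _) (fun _ _ _ => add_mul _ _ _)]
  refine Finsupp.sum_congr fun φ _ => ?_
  rw [Finsupp.sum_smul_index (fun _ => zero_mul _), Finsupp.mul_sum]
  exact Finsupp.sum_congr fun x _ => mul_assoc _ _ _

/-- The `ℤ₂`-vector space underlying a CABA: the algebra `(X, h ∘ α)`. -/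
noncomputable def Nbhd.Algebra.toVec {X : Type uX} (𝔸 : Nbhd.Algebra X) : Vec.Algebra X where
  str := fun φ => 𝔸.str (alpha φ)
  str_unit := fun x => by rw [alpha_unit, 𝔸.str_unit]
  str_mult := fun Φ => by
    have e : Vec.map (fun φ => 𝔸.str (alpha φ)) Φ = Vec.map 𝔸.str (Vec.map alpha Φ) :=
      Finsupp.mapDomain_comp
    rw [alpha_mult, 𝔸.str_mult, e, alpha_map 𝔸.str]

/-! ### CABA-structured deterministic automata -/

/-- Bialgebras for the distributive law between the neighbourhood monad and `F`. -/
structure Bialgebra (A : Type uA) (X : Type uX) extends Nbhd.Algebra X where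
  k : X → F A X
  k_str : ∀ U : Nbhd X, k (str U) = F.map str (Nbhd.law (Nbhd.map k U))

/-- The `x`-pointed bialgebra `𝔹` is minimal and accepts `L`: the state `x` accepts `L`,
every state is reachable by an element of the neighbourhood monad applied to `A*`,
and no two different states accept the same language. -/
structure Bialgebra.IsMinimalFor {A : Type uA} {X : Type uX} (𝔹 : Bialgebra A X) (x : X)
    (L : Language A) : Prop where
  accepts : IsCharFun (obs 𝔹.k x) L
  reachable : Function.Surjective fun U : Nbhd (List A) => 𝔹.str (Nbhd.map (run 𝔹.k x) U)
  observable : Function.Injective (obs 𝔹.k)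

/-! ### Weighted automata -/

/-- Pointed `ℤ₂`-weighted automata with state set `Y`; both the successors of a state and the
initial state are formal `ℤ₂`-linear combinations of states. -/
structure WeightedAutomaton (A : Type uA) (Y : Type uY) where
  step : Y → F A (Vec Y)
  start : Vec Y

namespace WeightedAutomaton

variable {A : Type uA} {Y : Type uY}

/-- The determinisation of a weighted automaton. -/
noncomputable def det (𝒴 : WeightedAutomaton A Y) (φ : Vec Y) : F A (Vec Y) :=
  F.map Vec.mult (Vec.law (Vec.map 𝒴.step φ))

/-- The language accepted by a single state of a weighted automaton. -/
noncomputable def obsState (𝒴 : WeightedAutomaton A Y) (y : Y) : Lang A :=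
  obs 𝒴.det (Vec.unit y)

/-- The weighted automaton accepts the language `L`. -/
def Accepts (𝒴 : WeightedAutomaton A Y) (L : Language A) : Prop :=
  IsCharFun (obs 𝒴.det 𝒴.start) L

/-- The vector space closure and the CABA closure of the set of the languages accepted by the
states coincide. -/
def IsClosed (𝒴 : WeightedAutomaton A Y) : Prop :=
  vecClosure (Set.range 𝒴.obsState) = cabaClosure (Set.range 𝒴.obsState)

end WeightedAutomaton

/-- For the minimal `x`-pointed bialgebra `𝔹` for a language, the minimal xor-CABA automaton
for that language with respect to a basis of the vector space underlying `𝔹`. -/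
def xorCABAAutomaton {A : Type uA} {X : Type uX} {Y : Type uY} (𝔹 : Bialgebra A X) (x : X)
    (b : Vec.Basis 𝔹.toAlgebra.toVec Y) : WeightedAutomaton A Y where
  step := fun y => F.map b.d (𝔹.k (b.i y))
  start := b.d x

end XorCABA

namespace XorCABA

/-! The CABA generated by a set of languages consists of the languages that separate only words
already separated by that set. So `cabaClosure` is a closure operator, contains `vecClosure`, and
preserves finiteness. For a minimal bialgebra, `obs` is an injective CABA homomorphism whose image
is the CABA generated by the derivatives of `L` (`range_obs`). A regular language has finitely many
derivatives, so this CABA is finite, and the derivatives also provide the bialgebra showing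
existence. The states of the determinised xor-CABA automaton accept exactly the languages in this
CABA, hence it is closed. The languages of any closed automaton for `L` form a CABA containing the
derivatives of `L`, hence contain this one (`range_obs_subset`). The basis languages are thus
linearly independent in the span of the `Z`-indexed state languages, and comparing ranks gives the
bound. -/

/-! ### CABA closures -/

theorem mem_cabaClosure_range_iff {A : Type uA} {ι : Type uX} (f : ι → Lang A) (l : Lang A) :
    l ∈ cabaClosure (Set.range f) ↔ ∀ v v', (∀ j, f j v = f j v') → l v = l v' := by
  classical
  constructor
  · rintro ⟨U, rfl⟩ v v' h
    refine congrArg U (funext ?_)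
    rintro ⟨_, j, rfl⟩
    exact h j
  · intro h
    -- Only the values at evaluations `s ↦ s v` matter; the default 0 elsewhere is arbitrary. The
    -- hypothesis on `l` makes the choice of `v` harmless.
    refine ⟨fun φ => if e : ∃ v, φ = fun s => s.1 v then l e.choose else 0, ?_⟩
    funext v
    have e : ∃ v', (fun s : Set.range f => s.1 v) = fun s => s.1 v' := ⟨v, rfl⟩
    change (if e : ∃ v', (fun s : Set.range f => s.1 v) = fun s => s.1 v'
      then l e.choose else 0) = l v
    rw [dif_pos e]
    exact (h _ _ fun j => congrFun e.choose_spec ⟨f j, j, rfl⟩).symm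

theorem mem_cabaClosure_iff {A : Type uA} (S : Set (Lang A)) (l : Lang A) :
    l ∈ cabaClosure S ↔ ∀ v v', (∀ s ∈ S, s v = s v') → l v = l v' := by
  have h := mem_cabaClosure_range_iff (fun s : S => s.1) l
  rw [Subtype.range_val] at h
  simpa using h

theorem exists_nbhd_iff {A : Type uA} {ι : Type uX} (f : ι → Lang A) (l : Lang A) :
    (∃ U : Nbhd ι, Nbhd.langStr (Nbhd.map f U) = l) ↔ l ∈ cabaClosure (Set.range f) := by
  constructor
  · rintro ⟨U, rfl⟩
    exact (mem_cabaClosure_range_iff f _).2 fun v v' h => congrArg U (funext h)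
  · rintro ⟨U, rfl⟩
    choose g hg using fun s : Set.range f => s.2
    refine ⟨Nbhd.map g U, ?_⟩
    beta_reduce
    rw [← funext hg]
    rfl

theorem cabaClosure_subset_cabaClosure {A : Type uA} {S T : Set (Lang A)}
    (h : S ⊆ cabaClosure T) : cabaClosure S ⊆ cabaClosure T := fun l hl =>
  (mem_cabaClosure_iff T l).2 fun v v' e =>
    (mem_cabaClosure_iff S l).1 hl v v' fun s hs => (mem_cabaClosure_iff T s).1 (h hs) v v' e

theorem finite_cabaClosure {A : Type uA} {S : Set (Lang A)} (hS : S.Finite) :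
    (cabaClosure S).Finite := by
  have := hS.to_subtype
  exact Set.finite_range _

/-! ### Derivatives of languages -/

/-- The left derivative of a language by a word. -/
def deriv {A : Type uA} (ξ : Lang A) (w : List A) : Lang A := fun v => ξ (w ++ v)

theorem obs_run {A : Type uA} {X : Type uX} (k : X → F A X) (x : X) (w : List A) :
    obs k (run k x w) = deriv (obs k x) w := by
  induction w generalizing x with
  | nil => rfl
  | cons a w ih => exact ih _

/-- Myhill–Nerode: the derivatives are the characteristic functions of the left quotients of `L`. -/
theorem finite_range_deriv {A : Type uA} {ξ : Lang A} {L : Language A} (h : IsCharFun ξ L)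
    (hL : L.IsRegular) : (Set.range (deriv ξ)).Finite := by
  classical
  refine (hL.finite_range_leftQuotient.image
    fun (M : Language A) (v : List A) => if v ∈ M then (1 : Two) else 0).subset ?_
  rintro _ ⟨w, rfl⟩
  refine ⟨_, ⟨w, rfl⟩, funext fun v => ?_⟩
  have two : ∀ c : Two, ¬ c = 1 → 0 = c := by decide
  have e : v ∈ L.leftQuotient w ↔ deriv ξ w v = 1 := (h (w ++ v)).symm
  by_cases hv : v ∈ L.leftQuotient w
  · simp only [if_pos hv]
    exact (e.1 hv).symm
  · simp only [if_neg hv]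
    exact two _ (mt e.2 hv)

/-! ### Existence of the minimal bialgebra -/

/-- The bialgebra carried by the CABA that the derivatives of a language generate. -/
def derivBialgebra {A : Type uA} (ξ : Lang A) :
    Bialgebra A (cabaClosure (Set.range (deriv ξ))) where
  str U := ⟨Nbhd.langStr (Nbhd.map Subtype.val U), (mem_cabaClosure_range_iff _ _).2
    fun _ _ h => congrArg U (funext fun l => (mem_cabaClosure_range_iff _ _).1 l.2 _ _ h)⟩
  str_unit _ := rfl
  str_mult _ := rfl
  k l := (l.1 [], fun a => ⟨fun v => l.1 (a :: v), (mem_cabaClosure_range_iff _ _).2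
    fun v v' h => (mem_cabaClosure_range_iff _ _).1 l.2 _ _ fun w => by
      -- The derivative by `w` at `a :: v` is the derivative by `w ++ [a]` at `v`.
      simpa [deriv] using h (w ++ [a])⟩)
  k_str _ := rfl

theorem obs_derivBialgebra {A : Type uA} (ξ : Lang A)
    (l : cabaClosure (Set.range (deriv ξ))) : obs (derivBialgebra ξ).k l = l.1 := by
  funext w
  induction w generalizing l with
  | nil => rfl
  | cons a w ih => exact ih _

/-! ### The languages accepted by the states of a bialgebra -/

theorem Bialgebra.obs_str {A : Type uA} {X : Type uX} (𝔹 : Bialgebra A X) (U : Nbhd X) :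
    obs 𝔹.k (𝔹.str U) = Nbhd.langStr (Nbhd.map (obs 𝔹.k) U) := by
  funext w
  induction w generalizing U with
  | nil => exact congrArg Prod.fst (𝔹.k_str U)
  | cons a w ih =>
    have e := congrFun (congrArg Prod.snd (𝔹.k_str U)) a
    change obs 𝔹.k ((𝔹.k (𝔹.str U)).2 a) w = _
    rw [e]
    exact ih _

theorem isMinimalFor_derivBialgebra {A : Type uA} {ξ : Lang A} {L : Language A}
    (h : IsCharFun ξ L) : (derivBialgebra ξ).IsMinimalFor
      ⟨ξ, (mem_cabaClosure_range_iff _ _).2 fun _ _ e => e []⟩ L where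
  accepts := by rwa [obs_derivBialgebra]
  reachable l := by
    obtain ⟨U, hU⟩ := (exists_nbhd_iff _ _).2 l.2
    refine ⟨U, Subtype.ext ?_⟩
    rw [← obs_derivBialgebra, Bialgebra.obs_str, ← hU]
    funext v
    refine congrArg U (funext fun w => ?_)
    change obs _ (run _ _ w) v = _
    rw [obs_run, obs_derivBialgebra]
    rfl
  observable l l' e := by
    rw [obs_derivBialgebra, obs_derivBialgebra] at e
    exact Subtype.ext e

/-- Since `obs` is a CABA homomorphism, it carries the elements generated by the states reached from
`x` to those generated by the derivatives; reachability says that these are all states. -/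
theorem Bialgebra.IsMinimalFor.range_obs {A : Type uA} {X : Type uX} {𝔹 : Bialgebra A X} {x : X}
    {L : Language A} (h : 𝔹.IsMinimalFor x L) :
    Set.range (obs 𝔹.k) = cabaClosure (Set.range (deriv (obs 𝔹.k x))) := by
  have key : ∀ U : Nbhd (List A), obs 𝔹.k (𝔹.str (Nbhd.map (run 𝔹.k x) U)) =
      Nbhd.langStr (Nbhd.map (deriv (obs 𝔹.k x)) U) := fun U => by
    rw [𝔹.obs_str, ← funext (obs_run 𝔹.k x)]
    rfl
  ext l
  rw [← exists_nbhd_iff]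
  constructor
  · rintro ⟨z, rfl⟩
    obtain ⟨U, rfl⟩ := h.reachable z
    exact ⟨U, (key U).symm⟩
  · rintro ⟨U, rfl⟩
    exact ⟨_, key U⟩

theorem Bialgebra.IsMinimalFor.finite {A : Type uA} {X : Type uX} {𝔹 : Bialgebra A X} {x : X}
    {L : Language A} (h : 𝔹.IsMinimalFor x L) (hL : L.IsRegular) : Finite X := by
  have hf := finite_cabaClosure (finite_range_deriv h.accepts hL)
  rw [← h.range_obs] at hf
  have := hf.to_subtype
  exact Finite.of_injective_finite_range h.observable

/-! ### Linear combinations of languages -/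

theorem langStr_alpha {A : Type uA} (U : Vec (Lang A)) :
    Nbhd.langStr (alpha U) = Finsupp.linearCombination Two id U := by
  funext w
  rw [Finsupp.linearCombination_apply, Finsupp.sum_apply']
  rfl

theorem Vec.out_eq (φ : Vec Two) : Vec.out φ = φ.sum fun x c => c * x := by
  -- In the two-element field, only the coefficient of 1 contributes to the weighted sum.
  have two : ∀ x c : Two, (if x = 1 then c else 0) = c * x := by decide
  conv_lhs => rw [← Finsupp.sum_single φ]
  rw [Vec.out, Finsupp.sum_apply]
  refine Finsupp.sum_congr fun x _ => ?_
  rw [Finsupp.single_apply, two]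

theorem Vec.out_map {X : Type uX} (f : X → Two) (φ : Vec X) :
    Vec.out (Vec.map f φ) = Finsupp.linearCombination Two f φ := by
  rw [Vec.out_eq, Vec.map,
    Finsupp.sum_mapDomain_index (fun _ => zero_mul _) (fun _ _ _ => add_mul _ _ _)]
  rfl

theorem Vec.langStr_map {A : Type uA} {X : Type uX} (f : X → Lang A) (φ : Vec X) :
    Vec.langStr (Vec.map f φ) = Finsupp.linearCombination Two f φ := by
  have e : Vec.langStr (Vec.map f φ) = Finsupp.linearCombination Two id (Vec.map f φ) := by
    funext w
    rw [Vec.langStr, Vec.out_map, Finsupp.linearCombination_apply,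
      Finsupp.linearCombination_apply, Finsupp.sum_apply']
    rfl
  rw [e, Vec.map, Finsupp.linearCombination_mapDomain]
  rfl

theorem vecClosure_eq_span {A : Type uA} (S : Set (Lang A)) :
    vecClosure S = Submodule.span Two S := by
  rw [Finsupp.span_eq_range_linearCombination, LinearMap.coe_range]
  exact congrArg Set.range (funext fun U => Vec.langStr_map _ U)

theorem vecClosure_subset_cabaClosure {A : Type uA} (S : Set (Lang A)) :
    vecClosure S ⊆ cabaClosure S := by
  rintro _ ⟨U, rfl⟩
  refine ⟨alpha U, ?_⟩
  beta_reduce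
  rw [← alpha_map, langStr_alpha, Vec.langStr_map, Vec.map, Finsupp.linearCombination_mapDomain]
  rfl

theorem Bialgebra.obs_toVec_str {A : Type uA} {X : Type uX} {Y : Type uY} (𝔹 : Bialgebra A X)
    (i : Y → X) (φ : Vec Y) : obs 𝔹.k (𝔹.toAlgebra.toVec.str (Vec.map i φ)) =
      Finsupp.linearCombination Two (fun y => obs 𝔹.k (i y)) φ := by
  change obs 𝔹.k (𝔹.str (alpha (Vec.map i φ))) = _
  rw [𝔹.obs_str, ← alpha_map, langStr_alpha, Vec.map, Vec.map, Finsupp.linearCombination_mapDomain,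
    Finsupp.linearCombination_mapDomain]
  rfl

/-- The languages accepted by the states of a bialgebra form a vector space. -/
noncomputable def Bialgebra.obsSubmodule {A : Type uA} {X : Type uX} (𝔹 : Bialgebra A X) :
    Submodule Two (Lang A) :=
  LinearMap.range (Finsupp.linearCombination Two (obs 𝔹.k))

theorem Bialgebra.mem_obsSubmodule {A : Type uA} {X : Type uX} (𝔹 : Bialgebra A X) (l : Lang A) :
    l ∈ 𝔹.obsSubmodule ↔ ∃ z, obs 𝔹.k z = l := by
  constructor
  · rintro ⟨φ, rfl⟩
    exact ⟨_, 𝔹.obs_toVec_str id φ⟩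
  · rintro ⟨z, rfl⟩
    exact ⟨Finsupp.single z 1, by simp⟩

/-- An ordinary basis of the space of accepted languages is pulled back along `obs`, which is
injective and linear. -/
theorem Bialgebra.exists_basis {A : Type uA} {X : Type uX} [Finite X] (𝔹 : Bialgebra A X)
    (hinj : Function.Injective (obs 𝔹.k)) :
    ∃ Y : Type uX, Nonempty (Vec.Basis 𝔹.toAlgebra.toVec Y) := by
  have : Module.Finite Two 𝔹.obsSubmodule :=
    inferInstanceAs (Module.Finite Two (LinearMap.range _))
  let b := (Module.finBasis Two 𝔹.obsSubmodule).reindex Equiv.ulift.{uX}.symm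
  choose g hg using fun l : 𝔹.obsSubmodule => (𝔹.mem_obsSubmodule l.1).1 l.2
  have key : ∀ φ, obs 𝔹.k (𝔹.toAlgebra.toVec.str (Vec.map (fun y => g (b y)) φ)) =
      (b.repr.symm φ : 𝔹.obsSubmodule) := fun φ => by
    rw [𝔹.obs_toVec_str, b.repr_symm_apply]
    simp only [hg]
    exact (Finsupp.apply_linearCombination Two 𝔹.obsSubmodule.subtype b φ).symm
  exact ⟨_, ⟨{
    i := fun y => g (b y)
    d := fun z => b.repr ⟨obs 𝔹.k z, (𝔹.mem_obsSubmodule _).2 ⟨z, rfl⟩⟩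
    str_map_d := fun z => hinj (by rw [key, LinearEquiv.symm_apply_apply])
    d_str_map := fun φ => b.repr.symm.injective (Subtype.ext (by
      rw [LinearEquiv.symm_apply_apply, ← key])) }⟩⟩

theorem Vec.Basis.injective_str_map {X : Type uX} {Y : Type uY} {𝔸 : Vec.Algebra X}
    (b : Vec.Basis 𝔸 Y) : Function.Injective fun φ : Vec Y => 𝔸.str (Vec.map b.i φ) :=
  Function.LeftInverse.injective b.d_str_map

theorem Vec.Basis.finite {X : Type uX} {Y : Type uY} [Finite X] {𝔸 : Vec.Algebra X}
    (b : Vec.Basis 𝔸 Y) : Finite Y :=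
  Finite.of_injective _
    (b.injective_str_map.comp (Finsupp.single_left_injective (one_ne_zero (α := Two))))

/-! ### The languages accepted by the states of a weighted automaton -/

namespace WeightedAutomaton

variable {A : Type uA} {Y : Type uY}

theorem det_fst (𝒴 : WeightedAutomaton A Y) (φ : Vec Y) :
    (𝒴.det φ).1 = Finsupp.linearCombination Two (fun y => (𝒴.step y).1) φ := by
  change Vec.out (Vec.map Prod.fst (Vec.map 𝒴.step φ)) = _
  rw [Vec.out_map, Vec.map, Finsupp.linearCombination_mapDomain]
  rfl

theorem det_snd (𝒴 : WeightedAutomaton A Y) (φ : Vec Y) (a : A) :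
    (𝒴.det φ).2 a = Finsupp.linearCombination Two (fun y => (𝒴.step y).2 a) φ := by
  change Finsupp.linearCombination Two id
    (Vec.map (fun g : A → Vec Y => g a) (Vec.map Prod.snd (Vec.map 𝒴.step φ))) = _
  simp only [Vec.map, Finsupp.linearCombination_mapDomain]
  rfl

/-- For each fixed word, acceptance is a linear functional of the determinised state, so `obs` is
determined by its values on single states. -/
theorem obs_det (𝒴 : WeightedAutomaton A Y) (φ : Vec Y) :
    obs 𝒴.det φ = Finsupp.linearCombination Two 𝒴.obsState φ := by
  have h : ∀ w, ∃ f : Vec Y →ₗ[Two] Two, ∀ φ, f φ = obs 𝒴.det φ w := by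
    intro w
    induction w with
    | nil => exact ⟨_, fun φ => (𝒴.det_fst φ).symm⟩
    | cons a w ih =>
      obtain ⟨f, hf⟩ := ih
      refine ⟨f ∘ₗ Finsupp.linearCombination Two fun y => (𝒴.step y).2 a, fun φ => ?_⟩
      rw [LinearMap.comp_apply, ← det_snd, hf]
      rfl
  choose f hf using h
  have e : LinearMap.pi f = Finsupp.linearCombination Two 𝒴.obsState :=
    Finsupp.lhom_ext' fun y => LinearMap.ext_ring (by
      funext w
      simpa using! hf w (Finsupp.single y 1))
  rw [← e]
  exact funext fun w => (hf w φ).symm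

theorem range_obs_det (𝒴 : WeightedAutomaton A Y) :
    Set.range (obs 𝒴.det) = vecClosure (Set.range 𝒴.obsState) := by
  rw [vecClosure_eq_span, ← Finsupp.range_linearCombination, LinearMap.coe_range]
  exact congrArg Set.range (funext 𝒴.obs_det)

end WeightedAutomaton

/-! ### The minimal xor-CABA automaton -/

theorem obs_det_xorCABAAutomaton {A : Type uA} {X : Type uX} {Y : Type uY} (𝔹 : Bialgebra A X)
    (x : X) (b : Vec.Basis 𝔹.toAlgebra.toVec Y) (φ : Vec Y) :
    obs (xorCABAAutomaton 𝔹 x b).det φ = obs 𝔹.k (𝔹.toAlgebra.toVec.str (Vec.map b.i φ)) := by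
  funext w
  induction w generalizing φ with
  | nil =>
    rw [𝔹.obs_toVec_str, Finsupp.linearCombination_apply, Finsupp.sum_apply']
    exact (xorCABAAutomaton 𝔹 x b).det_fst φ
  | cons a w ih =>
    change obs _ (((xorCABAAutomaton 𝔹 x b).det φ).2 a) w = _
    rw [ih, 𝔹.obs_toVec_str, 𝔹.obs_toVec_str, WeightedAutomaton.det_snd,
      Finsupp.apply_linearCombination]
    rw [Finsupp.linearCombination_apply, Finsupp.linearCombination_apply, Finsupp.sum_apply',
      Finsupp.sum_apply']
    refine Finsupp.sum_congr fun y _ => ?_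
    have e : Finsupp.linearCombination Two (fun y => obs 𝔹.k (b.i y))
        (b.d ((𝔹.k (b.i y)).2 a)) = obs 𝔹.k ((𝔹.k (b.i y)).2 a) := by
      rw [← 𝔹.obs_toVec_str, b.str_map_d]
    exact congrArg (fun l : Lang A => φ y • l w) e

theorem range_obs_det_xorCABAAutomaton {A : Type uA} {X : Type uX} {Y : Type uY}
    (𝔹 : Bialgebra A X) (x : X) (b : Vec.Basis 𝔹.toAlgebra.toVec Y) :
    Set.range (obs (xorCABAAutomaton 𝔹 x b).det) = Set.range (obs 𝔹.k) := by
  rw [funext (obs_det_xorCABAAutomaton 𝔹 x b)]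
  exact Function.Surjective.range_comp (fun z => ⟨b.d z, b.str_map_d z⟩) (obs 𝔹.k)

theorem xorCABAAutomaton_accepts {A : Type uA} {X : Type uX} {Y : Type uY} {𝔹 : Bialgebra A X}
    {x : X} {L : Language A} (h : IsCharFun (obs 𝔹.k x) L)
    (b : Vec.Basis 𝔹.toAlgebra.toVec Y) : (xorCABAAutomaton 𝔹 x b).Accepts L := by
  rw [WeightedAutomaton.Accepts, obs_det_xorCABAAutomaton]
  change IsCharFun (obs 𝔹.k (𝔹.toAlgebra.toVec.str (Vec.map b.i (b.d x)))) L
  rwa [b.str_map_d]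

theorem xorCABAAutomaton_isClosed {A : Type uA} {X : Type uX} {Y : Type uY} {𝔹 : Bialgebra A X}
    {x : X} {L : Language A} (h : 𝔹.IsMinimalFor x L)
    (b : Vec.Basis 𝔹.toAlgebra.toVec Y) : (xorCABAAutomaton 𝔹 x b).IsClosed := by
  refine (vecClosure_subset_cabaClosure _).antisymm ?_
  rw [← WeightedAutomaton.range_obs_det, range_obs_det_xorCABAAutomaton, h.range_obs]
  -- The vector space closure is by now rewritten as a CABA closure, so containing the generators
  -- suffices.
  refine cabaClosure_subset_cabaClosure ?_
  rw [← h.range_obs, ← range_obs_det_xorCABAAutomaton 𝔹 x b]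
  rintro _ ⟨y, rfl⟩
  exact ⟨_, rfl⟩

/-! ### Size-minimality -/

theorem IsCharFun.unique {A : Type uA} {ξ ξ' : Lang A} {L : Language A} (h : IsCharFun ξ L)
    (h' : IsCharFun ξ' L) : ξ = ξ' := by
  have two : ∀ c c' : Two, (c = 1 ↔ c' = 1) → c = c' := by decide
  exact funext fun w => two _ _ ((h w).trans (h' w).symm)

theorem Bialgebra.IsMinimalFor.range_obs_subset {A : Type uA} {X : Type uX} {Z : Type uZ}
    {𝔹 : Bialgebra A X} {x : X} {L : Language A} (h : 𝔹.IsMinimalFor x L)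
    {𝒴 : WeightedAutomaton A Z} (hL : 𝒴.Accepts L) (hc : 𝒴.IsClosed) :
    Set.range (obs 𝔹.k) ⊆ Set.range (obs 𝒴.det) := by
  rw [h.range_obs, 𝒴.range_obs_det, hc]
  refine cabaClosure_subset_cabaClosure ?_
  rw [← hc, ← 𝒴.range_obs_det, h.accepts.unique hL]
  rintro _ ⟨w, rfl⟩
  exact ⟨_, obs_run _ _ w⟩

/-- Coordinates `c` of `f` with respect to `g` factor the injective map through the free space on
`Z`, so the free space on `Y` embeds there. No independence of `g` is needed, and `Z` may be
infinite. -/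
theorem lift_mk_le_of_range_linearCombination_subset {K : Type*} [Field K] {V : Type*}
    [AddCommGroup V] [Module K V] {Y : Type uY} {Z : Type uZ} {f : Y → V} {g : Z → V}
    (hf : Function.Injective (Finsupp.linearCombination K f))
    (h : ∀ y, f y ∈ Set.range (Finsupp.linearCombination K g)) :
    Cardinal.lift.{uZ} (Cardinal.mk Y) ≤ Cardinal.lift.{uY} (Cardinal.mk Z) := by
  choose c hc using h
  have e : Finsupp.linearCombination K g ∘ₗ Finsupp.linearCombination K c =
      Finsupp.linearCombination K f :=
    Finsupp.lhom_ext' fun y => LinearMap.ext_ring (by simp [hc])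
  have hinj : LinearIndependent K c := by
    refine Function.Injective.of_comp (f := Finsupp.linearCombination K g) ?_
    rw [← LinearMap.coe_comp, e]
    exact hf
  have hrank := LinearMap.lift_rank_le_of_injective _ hinj
  rw [rank_finsupp_self, rank_finsupp_self] at hrank
  rw [← Cardinal.lift_le.{u_1}]
  simpa only [Cardinal.lift_lift] using hrank

end XorCABA

theorem mainTheorem9 {A : Type uA} (L : Language A) (hL : L.IsRegular) :
    -- the minimal CABA-structured deterministic automaton for `L` exists
    (∃ (X : Type uA) (𝔹 : XorCABA.Bialgebra A X) (x : X), 𝔹.IsMinimalFor x L) ∧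
    ∀ (X : Type uX) (𝔹 : XorCABA.Bialgebra A X) (x : X), 𝔹.IsMinimalFor x L →
      -- its underlying vector space has a basis
      (∃ Y : Type uX, Nonempty (XorCABA.Vec.Basis 𝔹.toAlgebra.toVec Y)) ∧
      -- the minimal xor-CABA automaton with respect to any basis is a finite member of the class
      -- and of minimal size in the class
      ∀ (Y : Type uY) (b : XorCABA.Vec.Basis 𝔹.toAlgebra.toVec Y),
        Finite Y ∧
        (XorCABA.xorCABAAutomaton 𝔹 x b).Accepts L ∧
        (XorCABA.xorCABAAutomaton 𝔹 x b).IsClosed ∧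
        ∀ (Z : Type uZ) (𝒴 : XorCABA.WeightedAutomaton A Z),
          𝒴.Accepts L → 𝒴.IsClosed →
            Cardinal.lift.{uZ} (Cardinal.mk Y) ≤ Cardinal.lift.{uY} (Cardinal.mk Z) := by
  classical
  refine ⟨⟨_, _, _, XorCABA.isMinimalFor_derivBialgebra
    (ξ := fun w => if w ∈ L then 1 else 0) fun w => by simp⟩, fun X 𝔹 x h => ?_⟩
  have := h.finite hL
  refine ⟨𝔹.exists_basis h.observable, fun Y b => ⟨b.finite,
    XorCABA.xorCABAAutomaton_accepts h.accepts b, XorCABA.xorCABAAutomaton_isClosed h b,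
    fun Z 𝒴 hZ hc => ?_⟩⟩
  have e := funext (𝔹.obs_toVec_str b.i)
  refine XorCABA.lift_mk_le_of_range_linearCombination_subset (K := XorCABA.Two)
    (f := fun y => XorCABA.obs 𝔹.k (b.i y)) (g := 𝒴.obsState) ?_ fun y => ?_
  · rw [← e]
    exact h.observable.comp b.injective_str_map
  · rw [← funext 𝒴.obs_det]
    exact h.range_obs_subset hZ hc ⟨_, rfl⟩
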